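/- For a prime power $q$ and integers $v,d\ge 1$ let $A_q^f(v,d)$ be the maximum cardinality of a set $\mathcal C$ of full flags $\{0\}<W_1<\dots<W_{v-1}<\mathbb F_q^v$ (with $\dim W_i=i$) such that $\sum_{i=1}^{v-1}\bigl(i-\dim(W_i\cap W_i')\bigr)\ge d$ for any two different flags $(W_1,\dots,W_{v-1})$, $(W_1',\dots,W_{v-1}')$ in $\mathcal C$. Proposition. Let $d\ge 1$ and $v$ be integers with $v\ge\hat v$, where $\hat v=\lceil 2\sqrt d\,\rceil$ (so that $\hat v\ge 2$), and put $$\beta=\frac{v(v-1)-\hat v(\hat v-1)}2+\hat v-d+\left\lfloor\frac{(\hat v-1)^2}4\right\rfloor .$$ Then $A_q^f(v,d)\le q^\beta+O\!\left(q^{\beta-1}\right)$ for fixed $v$ and $d$; that is, there is a constant $C$, depending only on $v$ and $d$, such that $A_q^f(v,d)\le q^\beta+C\,q^{\beta-1}$ for all prime powers $q$. -/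

import Mathlib

namespace FlagCode

/-- The injection distance `max (dim U) (dim W) - dim (U ∩ W)` of two subspaces of `F^v`.
The subtraction is never truncated, since `dim (U ∩ W) ≤ dim U`. -/
noncomputable def injDist {F : Type*} [Field F] {v : ℕ} (U W : Submodule F (Fin v → F)) : ℕ :=
  max (Module.finrank F U) (Module.finrank F W) - Module.finrank F (U ⊓ W : Submodule F (Fin v → F))

/-- Flags `{0} < W_{k_1} < ... < W_{k_m} < F^v` of type `T = {k_1 < ... < k_m}`. The members of a
flag have pairwise different dimensions, so the chain is indexed by the dimensions occurring. -/
@[ext]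
structure TypedFlag (F : Type*) [Field F] (v : ℕ) (T : Finset ℕ) where
  /-- the member of dimension `k`, for `k ∈ T` -/
  W : T → Submodule F (Fin v → F)
  strictMono : StrictMono W
  bot_lt : ∀ k, ⊥ < W k
  lt_top : ∀ k, W k < ⊤
  finrank_eq : ∀ k, Module.finrank F (W k) = (k : ℕ)

/-- Full flags of `F^v`: the flags of type `{1, ..., v - 1}`. -/
abbrev FullFlag (F : Type*) [Field F] (v : ℕ) : Type _ := TypedFlag F v (Finset.Ioo 0 v)

/-- The Grassmann distance of two flags of the same type. -/
noncomputable def grassmannDist {F : Type*} [Field F] {v : ℕ} {T : Finset ℕ}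
    (Λ Λ' : TypedFlag F v T) : ℕ :=
  ∑ k : T, injDist (Λ.W k) (Λ'.W k)

/-- The minimum Grassmann distance of a flag code; it is `∞` for codes of size at most `1`. -/
noncomputable def minDist {F : Type*} [Field F] {v : ℕ} {T : Finset ℕ}
    (C : Finset (TypedFlag F v T)) : ℕ∞ :=
  ⨅ Λ ∈ C, ⨅ Λ' ∈ C, ⨅ _ : Λ ≠ Λ', (grassmannDist Λ Λ' : ℕ∞)

/-- The maximum possible size `A_q^f(v, d; T)` of a flag code of type `T` in `F^v`, `q = #F`, with
minimum Grassmann distance at least `d`. For finite `F` the maximum exists (`isGreatest_maxSize`). -/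
noncomputable def maxSize (F : Type*) [Field F] (v d : ℕ) (T : Finset ℕ) : ℕ :=
  sSup {n : ℕ | ∃ C : Finset (TypedFlag F v T), (d : ℕ∞) ≤ minDist C ∧ C.card = n}

/-- The maximum possible size `A_q^f(v, d)` of a full flag code. -/
noncomputable def fullMaxSize (F : Type*) [Field F] (v d : ℕ) : ℕ :=
  maxSize F v d (Finset.Ioo 0 v)

theorem finite_typedFlag (F : Type*) [Field F] [Finite F] (v : ℕ) (T : Finset ℕ) :
    Finite (TypedFlag F v T) :=
  haveI : Finite (Submodule F (Fin v → F)) :=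
    Finite.of_injective (fun U => (U : Set (Fin v → F))) SetLike.coe_injective
  Finite.of_injective TypedFlag.W fun _ _ h => TypedFlag.ext h

theorem isGreatest_maxSize (F : Type*) [Field F] [Finite F] (v d : ℕ) (T : Finset ℕ) :
    IsGreatest {n : ℕ | ∃ C : Finset (TypedFlag F v T), (d : ℕ∞) ≤ minDist C ∧ C.card = n}
      (maxSize F v d T) := by
  haveI := finite_typedFlag F v T
  haveI := Fintype.ofFinite (TypedFlag F v T)
  have hb : BddAbove {n : ℕ | ∃ C : Finset (TypedFlag F v T),
      (d : ℕ∞) ≤ minDist C ∧ C.card = n} := by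
    refine ⟨Fintype.card (TypedFlag F v T), ?_⟩
    rintro n ⟨C, -, rfl⟩
    exact C.card_le_univ
  exact ⟨Nat.sSup_mem ⟨0, ∅, by simp [minDist], rfl⟩ hb, fun n hn => le_csSup hb hn⟩

/-- `v̂ = ⌈2 √d⌉`. -/
noncomputable def vHat (d : ℕ) : ℕ := ⌈2 * Real.sqrt (d : ℝ)⌉₊

/-- `β = (v (v - 1) - v̂ (v̂ - 1)) / 2 + v̂ - d + ⌊(v̂ - 1)² / 4⌋`, computed in `ℤ`; the division
by `2` is exact, because `x (x - 1)` is always even. -/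
noncomputable def beta (v d : ℕ) : ℤ :=
  ((v : ℤ) * ((v : ℤ) - 1) - (vHat d : ℤ) * ((vHat d : ℤ) - 1)) / 2
    + (vHat d : ℤ) - (d : ℤ) + ⌊((vHat d : ℝ) - 1) ^ 2 / 4⌋

end FlagCode

/-! Write `n = vHat d`, `v = m + n`, `d = ⌊(n-1)²/4⌋ + e`; the definition of `n` forces `1 ≤ e ≤
n/2`. If two flags of the code agree up to dimension `m`, their members of dimension `m + e` meet
only in the common `m`-space: one more common dimension pushes the distance below `d`
(`grassmannDist_lt`). Modulo that `m`-space these members form a partial spread, so at most about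
`q^(n-e)` flags share a given initial segment. Prescribing the first `m` members one at a time costs
factors of about `q^(v-1), ..., q^n`, and the exponents add up to `β`. Each of the `m + 1` estimates
loses a factor `1 + 2/q`. -/

namespace FlagCode

open Module Finset

/-! ### Counting partial spreads over a common subspace -/

section Counting

variable {F V : Type*} [Field F] [Finite F] [AddCommGroup V] [Module F V] [FiniteDimensional F V]

/-- Subspaces of dimension `j + e` that pairwise meet in a common `j`-dimensional subspace. -/
theorem card_mul_le_of_pairwise_inf (S : Finset (Submodule F V)) (U : Submodule F V) (j e : ℕ)
    (hU : finrank F U = j) (hS : ∀ A ∈ S, U ≤ A ∧ finrank F A = j + e)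
    (hd : ∀ A ∈ S, ∀ B ∈ S, A ≠ B → A ⊓ B ≤ U) :
    S.card * (Nat.card F ^ (j + e) - Nat.card F ^ j)
      ≤ Nat.card F ^ finrank F V - Nat.card F ^ j := by
  classical
  have : Finite V := Module.finite_of_finite F
  have := Fintype.ofFinite V
  have hc : ∀ A : Submodule F V,
      (Set.toFinset (A : Set V)).card = Nat.card F ^ finrank F A := fun A => by
    rw [Set.toFinset_card, ← Nat.card_eq_fintype_card]
    exact Module.natCard_eq_pow_finrank (K := F) (V := A)
  have hsd : ∀ A : Submodule F V, U ≤ A →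
      (Set.toFinset (A : Set V) \ Set.toFinset (U : Set V)).card
        = Nat.card F ^ finrank F A - Nat.card F ^ j := fun A hA => by
    rw [card_sdiff_of_subset (Set.toFinset_subset_toFinset.2 hA), hc, hc, hU]
  have hdisj : (S : Set (Submodule F V)).PairwiseDisjoint
      fun A => Set.toFinset (A : Set V) \ Set.toFinset (U : Set V) := by
    intro A hA B hB hAB
    rw [Function.onFun, Finset.disjoint_left]
    intro x hxA hxB
    simp only [mem_sdiff, Set.mem_toFinset, SetLike.mem_coe] at hxA hxB
    exact hxA.2 (hd A hA B hB hAB ⟨hxA.1, hxB.1⟩)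
  have htop := hsd ⊤ le_top
  rw [finrank_top] at htop
  rw [← htop, ← smul_eq_mul, ← sum_const, 
    ← sum_congr rfl fun A hA => (hsd A (hS A hA).1).trans (by rw [(hS A hA).2]),
    ← card_biUnion hdisj]
  refine card_le_card (biUnion_subset.2 fun A _ => sdiff_subset_sdiff ?_ subset_rfl)
  exact Set.toFinset_subset_toFinset.2 fun _ _ => trivial

/-- The number of such subspaces is at most `q ^ (n - e) * (1 + 2 / q)`, where `n` is the
codimension of the common intersection. -/
theorem card_le_of_pairwise_inf (S : Finset (Submodule F V)) (U : Submodule F V) (j e b : ℕ)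
    (he : 1 ≤ e) (hV : finrank F V = j + e + b) (hU : finrank F U = j)
    (hS : ∀ A ∈ S, U ≤ A ∧ finrank F A = j + e)
    (hd : ∀ A ∈ S, ∀ B ∈ S, A ≠ B → A ⊓ B ≤ U) :
    (S.card : ℝ) ≤ (Nat.card F : ℝ) ^ b * (1 + 2 / Nat.card F) := by
  have h := card_mul_le_of_pairwise_inf S U j e hU hS hd
  rw [hV] at h
  obtain ⟨f, rfl⟩ := Nat.exists_eq_add_of_le' he
  have hq : 2 ≤ Nat.card F := Finite.one_lt_card
  generalize Nat.card F = q at h hq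
  have h1 : q ^ j ≤ q ^ (j + (f + 1)) := Nat.pow_le_pow_right (by omega) (by omega)
  have h2 : q ^ j ≤ q ^ (j + (f + 1) + b) := Nat.pow_le_pow_right (by omega) (by omega)
  have h' : (S.card : ℝ) * ((q : ℝ) ^ (j + (f + 1)) - (q : ℝ) ^ j)
      ≤ (q : ℝ) ^ (j + (f + 1) + b) - (q : ℝ) ^ j := by exact_mod_cast h
  have hq' : (2 : ℝ) ≤ q := by exact_mod_cast hq
  have hqj : (0 : ℝ) < (q : ℝ) ^ j := by positivity
  have hf : (1 : ℝ) ≤ (q : ℝ) ^ f := one_le_pow₀ (by linarith)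
  have hpos : (0 : ℝ) < (q : ℝ) ^ f * q - 1 := by nlinarith
  have h3 : (S.card : ℝ) * ((q : ℝ) ^ f * q - 1) ≤ (q : ℝ) ^ f * q * (q : ℝ) ^ b - 1 := by
    refine le_of_mul_le_mul_left ?_ hqj
    calc _ = (S.card : ℝ) * ((q : ℝ) ^ (j + (f + 1)) - (q : ℝ) ^ j) := by ring
      _ ≤ _ := h'
      _ = _ := by ring
  refine le_of_mul_le_mul_right (h3.trans ?_) hpos
  have hb : (0 : ℝ) < (q : ℝ) ^ b := by positivity
  -- The surplus `q^b (2q^f - 1 - 2/q)` is nonnegative since `q ≥ 2`.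
  have key : (q : ℝ) ^ b * (1 + 2 / q) * ((q : ℝ) ^ f * q - 1)
      = (q : ℝ) ^ f * q * (q : ℝ) ^ b + (q : ℝ) ^ b * (2 * (q : ℝ) ^ f - 1 - 2 / q) := by
    field_simp
    ring
  have h4 : 2 / (q : ℝ) ≤ 1 := by rw [div_le_one (by linarith)]; exact hq'
  rw [key]
  nlinarith [mul_nonneg hb.le (by linarith : (0 : ℝ) ≤ 2 * (q : ℝ) ^ f - 1 - 2 / q)]

end Counting

/-! ### Distances of full flags -/

namespace TypedFlag

variable {F : Type*} [Field F] {v : ℕ}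

/-- The member of dimension `i` of a full flag, where `{0}` and `F^v` are counted as members. -/
noncomputable def member (Λ : FullFlag F v) (i : ℕ) : Submodule F (Fin v → F) :=
  if h : i ∈ Ioo 0 v then Λ.W ⟨i, h⟩ else if i = 0 then ⊥ else ⊤

theorem member_of_mem (Λ : FullFlag F v) {i : ℕ} (h : i ∈ Ioo 0 v) : Λ.member i = Λ.W ⟨i, h⟩ :=
  dif_pos h

theorem member_zero (Λ : FullFlag F v) : Λ.member 0 = ⊥ := by simp [member]

theorem member_of_ge (Λ : FullFlag F v) {i : ℕ} (h0 : 0 < i) (h : v ≤ i) : Λ.member i = ⊤ := by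
  rw [member, dif_neg (by simp [h]), if_neg h0.ne']

theorem finrank_member (Λ : FullFlag F v) {i : ℕ} (hi : i ≤ v) :
    finrank F (Λ.member i) = i := by
  obtain rfl | h0 := i.eq_zero_or_pos
  · rw [member_zero, finrank_bot]
  obtain rfl | hlt := hi.eq_or_lt
  · rw [member_of_ge Λ h0 le_rfl, finrank_top, finrank_fin_fun]
  · rw [member_of_mem Λ (mem_Ioo.2 ⟨h0, hlt⟩)]
    exact Λ.finrank_eq ⟨i, mem_Ioo.2 ⟨h0, hlt⟩⟩

theorem member_mono (Λ : FullFlag F v) : Monotone Λ.member := by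
  intro i j hij
  obtain rfl | h0 := i.eq_zero_or_pos
  · rw [member_zero]
    exact bot_le
  obtain hj | hj := le_or_gt v j
  · rw [member_of_ge Λ (h0.trans_le hij) hj]
    exact le_top
  · rw [member_of_mem Λ (mem_Ioo.2 ⟨h0, hij.trans_lt hj⟩),
      member_of_mem Λ (mem_Ioo.2 ⟨h0.trans_le hij, hj⟩)]
    exact Λ.strictMono.monotone hij

theorem grassmannDist_eq_sum (Λ Λ' : FullFlag F v) :
    grassmannDist Λ Λ'
      = ∑ i ∈ Ioo 0 v, (i - finrank F (Λ.member i ⊓ Λ'.member i : Submodule F (Fin v → F))) := by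
  rw [grassmannDist, ← sum_coe_sort (Ioo 0 v)]
  refine sum_congr rfl fun k _ => ?_
  rw [injDist, Λ.finrank_eq, Λ'.finrank_eq, max_self, member_of_mem Λ k.2, member_of_mem Λ' k.2]

theorem sub_finrank_inf_le (Λ Λ' : FullFlag F v) {i : ℕ} (hi : i ≤ v) :
    i - finrank F (Λ.member i ⊓ Λ'.member i : Submodule F (Fin v → F)) ≤ v - i := by
  have h := Submodule.finrank_sup_add_finrank_inf_eq (Λ.member i) (Λ'.member i)
  have h' := Submodule.finrank_le (Λ.member i ⊔ Λ'.member i)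
  rw [finrank_fin_fun] at h'
  rw [Λ.finrank_member hi, Λ'.finrank_member hi] at h
  omega

end TypedFlag

theorem sum_range_min (n : ℕ) : ∑ s ∈ range n, min s (n - s) = n ^ 2 / 4 := by
  induction n using Nat.twoStepInduction with
  | zero => simp
  | one => simp
  | more n ih _ =>
    have h : ∀ s ∈ range n, min (s + 1) (n + 2 - (s + 1)) = min s (n - s) + 1 := fun s hs => by
      rw [mem_range] at hs
      omega
    rw [sum_range_succ, sum_range_succ', sum_congr rfl h, sum_add_distrib, ih]
    simp only [sum_const, card_range, smul_eq_mul]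
    have : (n + 2) ^ 2 = n ^ 2 + 4 * (n + 1) := by ring
    rw [this, Nat.add_mul_div_left _ _ (by norm_num)]
    omega

/-- Full flags of `F^(m + n)` that agree up to dimension `m`, and whose members of dimension
`m + e` meet in more than that, have small distance. -/
theorem grassmannDist_lt {F : Type*} [Field F] {m n e : ℕ} (he : 1 ≤ e) (hen : 2 * e ≤ n)
    (Λ Λ' : FullFlag F (m + n)) (hm : ∀ i ≤ m, Λ.member i = Λ'.member i)
    (hlt : m < finrank F (Λ.member (m + e) ⊓ Λ'.member (m + e) :
      Submodule F (Fin (m + n) → F))) :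
    grassmannDist Λ Λ' < (n - 1) ^ 2 / 4 + e := by
  have h1 : ∀ i ∈ range (m + 1),
      i - finrank F (Λ.member i ⊓ Λ'.member i : Submodule F (Fin (m + n) → F)) = 0 := by
    intro i hi
    rw [mem_range] at hi
    rw [hm i (by omega), inf_idem, Λ'.finrank_member (by omega)]
    omega
  -- In dimension `i = m + 1 + s` the term is at most `v - i = n - 1 - s` and at most `i - m = s +
  -- 1`; from `i = m + e` on, the extra common vector improves `s + 1` to `s`.
  have h2 : ∀ s ∈ range (n - 1), m + 1 + s
      - finrank F (Λ.member (m + 1 + s) ⊓ Λ'.member (m + 1 + s) : Submodule F (Fin (m + n) → F))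
      ≤ min s (n - 1 - s) + if s < e - 1 then 1 else 0 := by
    intro s hs
    rw [mem_range] at hs
    have hcodim := Λ.sub_finrank_inf_le Λ' (i := m + 1 + s) (by omega)
    split_ifs with hse
    · have hle : Λ.member m ≤ Λ.member (m + 1 + s) ⊓ Λ'.member (m + 1 + s) :=
        le_inf (Λ.member_mono (by omega))
          ((hm m le_rfl).trans_le (Λ'.member_mono (by omega)))
      have := Submodule.finrank_mono hle
      rw [Λ.finrank_member (by omega)] at this
      omega
    · have := Submodule.finrank_mono (inf_le_inf
        (Λ.member_mono (by omega : m + e ≤ m + 1 + s))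
        (Λ'.member_mono (by omega : m + e ≤ m + 1 + s)))
      omega
  have h3 : ∑ s ∈ range (n - 1), (if s < e - 1 then 1 else 0) = e - 1 := by
    rw [sum_boole]
    have : (range (n - 1)).filter (· < e - 1) = range (e - 1) := by
      ext s
      simp only [mem_filter, mem_range]
      omega
    simp [this]
  have hsub : Ioo 0 (m + n) ⊆ range (m + 1 + (n - 1)) := by
    intro i hi
    rw [mem_Ioo] at hi
    rw [mem_range]
    omega
  rw [TypedFlag.grassmannDist_eq_sum]
  refine (sum_le_sum_of_subset hsub).trans_lt ?_
  rw [sum_range_add, sum_congr rfl h1, sum_const_zero, zero_add]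
  refine (sum_le_sum h2).trans_lt ?_
  rw [sum_add_distrib, sum_range_min, h3]
  omega

theorem le_grassmannDist_of_le_minDist {F : Type*} [Field F] {v d : ℕ} {T : Finset ℕ}
    {C : Finset (TypedFlag F v T)} (h : (d : ℕ∞) ≤ minDist C) {Λ Λ' : TypedFlag F v T}
    (hΛ : Λ ∈ C) (hΛ' : Λ' ∈ C) (hne : Λ ≠ Λ') : d ≤ grassmannDist Λ Λ' := by
  simp only [minDist, le_iInf_iff] at h
  exact_mod_cast h Λ hΛ Λ' hΛ' hne

/-! ### Bounding codes with a common initial segment -/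

section Code

variable {F : Type*} [Field F] [Finite F] {m n e : ℕ}

/-- Flag codes all of whose members agree up to dimension `m`. -/
theorem card_le_of_agree_upto (he : 1 ≤ e) (hen : 2 * e ≤ n) (C : Finset (FullFlag F (m + n)))
    (hC : ∀ Λ ∈ C, ∀ Λ' ∈ C, Λ ≠ Λ' → (n - 1) ^ 2 / 4 + e ≤ grassmannDist Λ Λ')
    (hm : ∀ Λ ∈ C, ∀ Λ' ∈ C, ∀ i ≤ m, Λ.member i = Λ'.member i) :
    (C.card : ℝ) ≤ (Nat.card F : ℝ) ^ (n - e) * (1 + 2 / Nat.card F) := by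
  classical
  obtain rfl | ⟨Λ₀, h₀⟩ := C.eq_empty_or_nonempty
  · simp only [card_empty, Nat.cast_zero]
    positivity
  have hle : ∀ Λ ∈ C, Λ₀.member m ≤ Λ.member (m + e) := fun Λ hΛ =>
    (hm Λ₀ h₀ Λ hΛ m le_rfl).trans_le (Λ.member_mono (by omega))
  have hne : ∀ Λ ∈ C, ∀ Λ' ∈ C, Λ ≠ Λ' →
      finrank F (Λ.member (m + e) ⊓ Λ'.member (m + e) : Submodule F (Fin (m + n) → F)) ≤ m :=
    fun Λ hΛ Λ' hΛ' h => not_lt.1 fun hlt =>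
      (hC Λ hΛ Λ' hΛ' h).not_gt (grassmannDist_lt he hen Λ Λ' (hm Λ hΛ Λ' hΛ') hlt)
  -- A shared member would be an intersection of dimension `m + e > m`.
  have hinj : Set.InjOn (fun Λ : FullFlag F (m + n) => Λ.member (m + e)) C := by
    intro Λ hΛ Λ' hΛ' h
    by_contra hcon
    have := hne Λ hΛ Λ' hΛ' hcon
    simp only at h
    rw [h, inf_idem, Λ'.finrank_member (by omega)] at this
    omega
  rw [← card_image_of_injOn hinj]
  refine card_le_of_pairwise_inf _ (Λ₀.member m) m e (n - e) he ?_
    (Λ₀.finrank_member (by omega)) ?_ ?_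
  · rw [finrank_fin_fun]
    omega
  · simp only [mem_image, forall_exists_index, and_imp, forall_apply_eq_imp_iff₂]
    exact fun Λ hΛ => ⟨hle Λ hΛ, Λ.finrank_member (by omega)⟩
  · simp only [mem_image, forall_exists_index, and_imp, forall_apply_eq_imp_iff₂]
    intro Λ hΛ Λ' hΛ' h
    refine (Submodule.eq_of_le_of_finrank_le (le_inf (hle Λ hΛ) (hle Λ' hΛ')) ?_).ge
    rw [Λ₀.finrank_member (by omega)]
    exact hne Λ hΛ Λ' hΛ' fun h' => h (by rw [h'])

/-- Flag codes all of whose members agree up to dimension `m - k`. -/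
theorem card_le_of_agree_upto_sub (he : 1 ≤ e) (hen : 2 * e ≤ n) (k : ℕ) (hk : k ≤ m)
    (C : Finset (FullFlag F (m + n)))
    (hC : ∀ Λ ∈ C, ∀ Λ' ∈ C, Λ ≠ Λ' → (n - 1) ^ 2 / 4 + e ≤ grassmannDist Λ Λ')
    (hm : ∀ Λ ∈ C, ∀ Λ' ∈ C, ∀ i ≤ m - k, Λ.member i = Λ'.member i) :
    (C.card : ℝ) ≤ (Nat.card F : ℝ) ^ (n - e + ∑ i ∈ range k, (n + i))
      * (1 + 2 / Nat.card F) ^ (k + 1) := by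
  classical
  induction k generalizing C with
  | zero => simpa using card_le_of_agree_upto he hen C hC hm
  | succ k ih =>
    obtain rfl | ⟨Λ₀, h₀⟩ := C.eq_empty_or_nonempty
    · simp only [card_empty, Nat.cast_zero]
      positivity
    set j := m - (k + 1) with hj
    set g : FullFlag F (m + n) → Submodule F (Fin (m + n) → F) := fun Λ => Λ.member (j + 1)
      with hg
    have hfib : ∀ A ∈ C.image g, ((C.filter (g · = A)).card : ℝ)
        ≤ (Nat.card F : ℝ) ^ (n - e + ∑ i ∈ range k, (n + i))
          * (1 + 2 / Nat.card F) ^ (k + 1) := by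
      intro A _
      refine ih (by omega) _ (fun Λ hΛ Λ' hΛ' => hC Λ (mem_filter.1 hΛ).1 Λ' (mem_filter.1 hΛ').1)
        fun Λ hΛ Λ' hΛ' i hi => ?_
      rw [mem_filter] at hΛ hΛ'
      obtain hij | rfl : i ≤ j ∨ i = j + 1 := by omega
      · exact hm Λ hΛ.1 Λ' hΛ'.1 i hij
      · exact hΛ.2.trans hΛ'.2.symm
    have hle : ∀ Λ ∈ C, Λ₀.member j ≤ Λ.member (j + 1) := fun Λ hΛ =>
      (hm Λ₀ h₀ Λ hΛ j le_rfl).trans_le (Λ.member_mono (by omega))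
    -- Distinct `(j+1)`-spaces over one `j`-space always meet in it, so the spread bound applies
    -- with `e = 1` and needs no distance hypothesis.
    have himg : ((C.image g).card : ℝ)
        ≤ (Nat.card F : ℝ) ^ (n + k) * (1 + 2 / Nat.card F) := by
      refine card_le_of_pairwise_inf _ (Λ₀.member j) j 1 (n + k) le_rfl ?_
        (Λ₀.finrank_member (by omega)) ?_ ?_
      · rw [finrank_fin_fun]
        omega
      · simp only [mem_image, forall_exists_index, and_imp, forall_apply_eq_imp_iff₂]
        exact fun Λ hΛ => ⟨hle Λ hΛ, Λ.finrank_member (by omega)⟩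
      · simp only [mem_image, forall_exists_index, and_imp, forall_apply_eq_imp_iff₂]
        intro Λ hΛ Λ' hΛ' h
        refine (Submodule.eq_of_le_of_finrank_le (le_inf (hle Λ hΛ) (hle Λ' hΛ')) ?_).ge
        rw [Λ₀.finrank_member (by omega)]
        by_contra! hlt
        have hf := Λ.finrank_member (i := j + 1) (by omega)
        have hf' := Λ'.finrank_member (i := j + 1) (by omega)
        have e1 := Submodule.eq_of_le_of_finrank_le
          (inf_le_left : Λ.member (j + 1) ⊓ Λ'.member (j + 1) ≤ _) (by omega)
        have e2 := Submodule.eq_of_le_of_finrank_le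
          (inf_le_right : Λ.member (j + 1) ⊓ Λ'.member (j + 1) ≤ _) (by omega)
        exact h (e1.symm.trans e2)
    rw [card_eq_sum_card_image g C, Nat.cast_sum]
    refine (sum_le_card_nsmul _ _ _ hfib).trans ?_
    rw [nsmul_eq_mul]
    refine (mul_le_mul_of_nonneg_right himg (by positivity)).trans_eq ?_
    rw [sum_range_succ]
    ring

end Code

/-! ### Numerical estimates and the exponent -/

/-- By convexity the power lies below its chord over `[0, 1]`. -/
theorem one_add_two_mul_pow_le {t : ℝ} (h0 : 0 ≤ t) (h1 : t ≤ 1) (k : ℕ) :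
    (1 + 2 * t) ^ k ≤ 1 + (3 ^ k - 1) * t := by
  induction k with
  | zero => simp
  | succ k ih =>
    have h3 : (1 : ℝ) ≤ 3 ^ k := one_le_pow₀ (by norm_num)
    rw [pow_succ]
    refine (mul_le_mul_of_nonneg_right ih (by positivity)).trans ?_
    have : (3 ^ k - 1) * (t * t) ≤ (3 ^ k - 1) * (t * 1) := by
      gcongr
    rw [pow_succ]
    linarith

theorem four_mul_le_vHat_sq (d : ℕ) : 4 * d ≤ vHat d ^ 2 := by
  have h : 2 * √(d : ℝ) ≤ vHat d := Nat.le_ceil _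
  have hs := Real.sq_sqrt (Nat.cast_nonneg (α := ℝ) d)
  have h0 := Real.sqrt_nonneg (d : ℝ)
  have : (4 * d : ℝ) ≤ (vHat d : ℝ) ^ 2 := by nlinarith
  exact_mod_cast this

theorem vHat_sub_one_sq_lt {d : ℕ} (hd : 1 ≤ d) : (vHat d - 1) ^ 2 < 4 * d := by
  have hd' : (0 : ℝ) < d := by exact_mod_cast hd
  have h0 := Real.sqrt_pos.2 hd'
  have hs := Real.sq_sqrt hd'.le
  have h : (vHat d : ℝ) < 2 * √(d : ℝ) + 1 := Nat.ceil_lt_add_one (by positivity)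
  have hpos : 1 ≤ vHat d := Nat.ceil_pos.2 (by positivity)
  have h1 : (1 : ℝ) ≤ vHat d := by exact_mod_cast hpos
  have : ((vHat d : ℝ) - 1) ^ 2 < 4 * d := by nlinarith
  rw [← Nat.cast_lt (α := ℝ)]
  push_cast [Nat.cast_sub hpos]
  exact this

/-- With `n = vHat d`, `(n-1)² < 4d ≤ n²`: the left part gives `e ≥ 1`, the right part `e ≤ ⌊n²/4⌋ -
⌊(n-1)²/4⌋ = ⌊n/2⌋`. -/
theorem exists_eq_add_of_vHat {d : ℕ} (hd : 1 ≤ d) :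
    ∃ e, 1 ≤ e ∧ 2 * e ≤ vHat d ∧ d = (vHat d - 1) ^ 2 / 4 + e := by
  have h1 := four_mul_le_vHat_sq d
  have h2 := vHat_sub_one_sq_lt hd
  obtain ⟨n, hn⟩ : ∃ n, vHat d = n + 1 :=
    Nat.exists_eq_add_of_le' (Nat.pos_of_ne_zero fun h => by rw [h] at h1; omega)
  rw [hn] at h1 h2 ⊢
  rw [Nat.add_sub_cancel] at *
  refine ⟨d - n ^ 2 / 4, by omega, ?_, by omega⟩
  have h3 : (n + 1) ^ 2 = n ^ 2 + 2 * n + 1 := by ring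
  obtain ⟨k, rfl | rfl⟩ := n.even_or_odd'
  · have : (2 * k) ^ 2 = 4 * k ^ 2 := by ring
    omega
  · have : (2 * k + 1) ^ 2 = 4 * (k ^ 2 + k) + 1 := by ring
    omega

theorem beta_eq {m d e : ℕ} (he : 2 * e ≤ vHat d) (h1 : 1 ≤ e)
    (hd : d = (vHat d - 1) ^ 2 / 4 + e) :
    beta (m + vHat d) d = ((vHat d - e + ∑ i ∈ range m, (vHat d + i) : ℕ) : ℤ) := by
  have hfloor : ⌊((vHat d : ℝ) - 1) ^ 2 / 4⌋ = (((vHat d - 1) ^ 2 / 4 : ℕ) : ℤ) := by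
    have : ((vHat d : ℝ) - 1) ^ 2 / 4 = (((vHat d - 1) ^ 2 : ℕ) : ℝ) / ((4 : ℕ) : ℝ) := by
      push_cast [Nat.cast_sub (by omega : 1 ≤ vHat d)]
      rfl
    rw [this, ← Int.natCast_floor_eq_floor (by positivity), Nat.floor_div_eq_div]
  have hsum : ∀ n : ℕ, ((m + n : ℕ) : ℤ) * (((m + n : ℕ) : ℤ) - 1) - (n : ℤ) * ((n : ℤ) - 1)
      = 2 * ((∑ i ∈ range m, (n + i) : ℕ) : ℤ) := fun n => by
    induction m with
    | zero => simp
    | succ m ih =>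
      rw [sum_range_succ]
      push_cast at ih ⊢
      linarith
  rw [beta, hfloor, hsum, Int.mul_ediv_cancel_left _ (by norm_num)]
  generalize (vHat d - 1) ^ 2 / 4 = w at *
  omega

end FlagCode

theorem mainTheorem5 (v d : ℕ) (hd : 1 ≤ d) (hv : FlagCode.vHat d ≤ v) :
    ∃ C : ℝ, ∀ (q : ℕ) (F : Type*) [Field F] [Finite F], Nat.card F = q →
      (FlagCode.fullMaxSize F v d : ℝ) ≤
        (q : ℝ) ^ FlagCode.beta v d + C * (q : ℝ) ^ (FlagCode.beta v d - 1) := by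
  obtain ⟨m, rfl⟩ := Nat.exists_eq_add_of_le' hv
  obtain ⟨e, he, hen, hde⟩ := FlagCode.exists_eq_add_of_vHat hd
  refine ⟨3 ^ (m + 1) - 1, fun q F _ _ hq => ?_⟩
  subst hq
  obtain ⟨C, hC, hcard⟩ := (FlagCode.isGreatest_maxSize F (m + FlagCode.vHat d) d
    (Finset.Ioo 0 (m + FlagCode.vHat d))).1
  have hq : (1 : ℝ) < Nat.card F := by exact_mod_cast Finite.one_lt_card
  have hmain := FlagCode.card_le_of_agree_upto_sub he hen m le_rfl C
    (fun Λ hΛ Λ' hΛ' h => hde ▸ FlagCode.le_grassmannDist_of_le_minDist hC hΛ hΛ' h)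
    (fun Λ _ Λ' _ i hi => by
      -- The recursion starts at `k = m`, where agreement is only required of the zero space.
      obtain rfl : i = 0 := by omega
      rw [Λ.member_zero, Λ'.member_zero])
  rw [FlagCode.fullMaxSize, ← hcard, FlagCode.beta_eq hen he hde,
    zpow_sub_one₀ (by positivity), zpow_natCast]
  refine hmain.trans ?_
  have ht := FlagCode.one_add_two_mul_pow_le (t := (Nat.card F : ℝ)⁻¹) (by positivity)
    (inv_le_one_of_one_le₀ hq.le) (m + 1)
  rw [← div_eq_mul_inv] at ht
  refine (mul_le_mul_of_nonneg_left ht (by positivity)).trans_eq ?_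
  ring
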